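/- Let $A=(a_{i,j})$ be a real $n\times n$ nonsingular $M$-matrix, i.e. $a_{i,j}\le 0$ for all $i\ne j$, $A$ is nonsingular, and all entries of $A^{-1}$ are nonnegative. Write $A=D-B$, where $D$ is the diagonal matrix with the same diagonal entries as $A$ (so $B=(b_{i,j})$ is entrywise nonnegative with zero diagonal), and set $A_{sym}=D-S(B)$, where $S(B)$ is the matrix with entries $(b_{i,j}b_{j,i})^{1/2}$. Let $\alpha>0$, and let $X$ and $\widetilde X$ be $\mathbb R^n$-valued $\alpha$-permanental random vectors determined by $A$ and $A_{sym}$ respectively; that is, for all $s_1,\dots,s_n\ge 0$, with $S=\mathrm{diag}(s_1,\dots,s_n)$, $$E\Big(e^{-\sum_{i=1}^n s_iX_i}\Big)=\frac1{|I+A^{-1}S|^{\alpha}},\qquad E\Big(e^{-\sum_{i=1}^n s_i\widetilde X_i}\Big)=\frac1{|I+A_{sym}^{-1}S|^{\alpha}},$$ where $|\cdot|$ denotes the determinant. Then for every function $g$ on $\mathbb R^n$ and every set $\mathcal B$ in the range of $g$ such that $g^{-1}(\mathcal B)$ is a Borel set, $$\frac{|A|^\alpha}{|A_{sym}|^\alpha}\,P\big(g(\widetilde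 X)\in\mathcal B\big)\le P\big(g(X)\in\mathcal B\big)\le\Big(1-\frac{|A|^\alpha}{|A_{sym}|^\alpha}\Big)+\frac{|A|^\alpha}{|A_{sym}|^\alpha}\,P\big(g(\widetilde X)\in\mathcal B\big).$$ -/

import Mathlib

open MeasureTheory

/-- `A` is a nonsingular M-matrix: its off-diagonal entries are nonpositive, it is nonsingular,
and its inverse is entrywise nonnegative. -/
structure IsNonsingularMMatrix {n : ℕ} (A : Matrix (Fin n) (Fin n) ℝ) : Prop where
  offDiag_nonpos : ∀ i j, i ≠ j → A i j ≤ 0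
  det_ne_zero : A.det ≠ 0
  inv_nonneg : ∀ i j, 0 ≤ A⁻¹ i j

/-- The diagonal part `D` of `A`. -/
def diagPart {n : ℕ} (A : Matrix (Fin n) (Fin n) ℝ) : Matrix (Fin n) (Fin n) ℝ :=
  Matrix.diagonal fun i => A i i

/-- The matrix `B` in the decomposition `A = D - B`, where `D` is the diagonal part of `A`. -/
def offDiagPart {n : ℕ} (A : Matrix (Fin n) (Fin n) ℝ) : Matrix (Fin n) (Fin n) ℝ :=
  diagPart A - A

/-- `S(C)`, the matrix with entries `(c_{ij} c_{ji})^{1/2}`, for `C` entrywise nonnegative. -/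
noncomputable def geomSymm {n : ℕ} (C : Matrix (Fin n) (Fin n) ℝ) : Matrix (Fin n) (Fin n) ℝ :=
  Matrix.of fun i j => Real.sqrt (C i j * C j i)

/-- `A_sym = D - S(B)`, where `A = D - B` with `D` the diagonal part of `A`. -/
noncomputable def symMatrix {n : ℕ} (A : Matrix (Fin n) (Fin n) ℝ) :
    Matrix (Fin n) (Fin n) ℝ :=
  diagPart A - geomSymm (offDiagPart A)

/-- The random vector `X` on the probability space `(Ω, P)` is `α`-permanental with kernel `R`:
`E exp(-∑ sᵢ Xᵢ) = 1 / |I + R S|^α` for all `s₁, …, sₙ ≥ 0`, where `S = diag(s₁, …, sₙ)`.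
(Where the right-hand side is nonzero, the equation forces the exponential to be integrable.) -/
structure IsPermanental {n : ℕ} {Ω : Type*} [MeasurableSpace Ω] (P : Measure Ω)
    (α : ℝ) (R : Matrix (Fin n) (Fin n) ℝ) (X : Ω → Fin n → ℝ) : Prop where
  aemeasurable : AEMeasurable X P
  laplace : ∀ s : Fin n → ℝ, (∀ i, 0 ≤ s i) →
    ∫ ω, Real.exp (-∑ i, s i * X ω i) ∂P = 1 / (1 + R * Matrix.diagonal s).det ^ α

/-- The `α`-permanental vector determined by `A`, i.e. the one with kernel `R = A⁻¹`. -/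
def IsPermanentalDeterminedBy {n : ℕ} {Ω : Type*} [MeasurableSpace Ω] (P : Measure Ω)
    (α : ℝ) (A : Matrix (Fin n) (Fin n) ℝ) (X : Ω → Fin n → ℝ) : Prop :=
  IsPermanental P α A⁻¹ X

/-!
The laws of `X` and `X̃` are compared through their Laplace transforms. Call a function of
`s ∈ [0, ∞)ⁿ` a Laplace transform (`IsLaplace`) if it is the Laplace transform of a finite measure
on the nonnegative orthant. This class is closed under nonnegative combinations, products
(convolution), convergent series, and `F ↦ exp F` and `F ↦ exp F - 1`, and it contains
`s ↦ (dᵢ + sᵢ)^(-β)` (a gamma law on a coordinate axis).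

Let `Z = (D + S)⁻¹`. The powers of `Z B` are summable, by comparison with the Neumann series of
`A⁻¹ D`, so `det (1 - Z B) = exp (-Q_B)` with `Q_B = ∑ tr ((Z B)^m) / m` (`det_one_sub_eq_exp`),
and
`1 / |I + A⁻¹ S|^α = |A|^α ∏ (dᵢ + sᵢ)^(-α) exp (α Q_B)`.
The same holds for `A_sym` with `S(B)` in place of `B`. Expanding the traces over closed walks, a
walk contributes to `Q_B`, `Q_{Bᵀ}` and `Q_{S(B)}` the same product of factors `1 / (dᵢ + sᵢ)`, with
coefficients `f`, `g` and `√(f g)` (`exists_walk_expansion`). Since `Q_B = Q_{Bᵀ}`, the inequality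
`f + g ≥ 2 √(f g)` makes `Q_B - Q_{S(B)}` a Laplace transform. Hence so is
`exp (α Q_B) - exp (α Q_{S(B)}) = exp (α Q_{S(B)}) (exp (α (Q_B - Q_{S(B)})) - 1)`,
and therefore the Laplace transform of `X` is `|A|^α / |A_sym|^α` times that of `X̃` plus the
Laplace transform of a measure. By uniqueness (`map_eq_of_integral_exp_eq`) the law of `X` dominates
`|A|^α / |A_sym|^α` times the law of `X̃`, which is the lower bound; the upper bound is the lower
bound for the complementary event.
-/

/-! ### The logarithm of a determinant as a series of traces -/

section LogDet

open Matrix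

variable {ι : Type*} [Fintype ι] [DecidableEq ι]

/-- Jacobi's formula along the line `h ↦ 1 + h M`, at `h = 0`. -/
lemma hasDerivAt_det_one_add_smul (M : Matrix ι ι ℝ) :
    HasDerivAt (fun h : ℝ => (1 + h • M).det) M.trace 0 := by
  have h1 := (Polynomial.hasDerivAt
    (Matrix.det (1 + (Polynomial.X : Polynomial ℝ) • M.map Polynomial.C)) (0 : ℝ))
  rw [Matrix.derivative_det_one_add_X_smul] at h1
  refine h1.congr_of_eventuallyEq (Filter.Eventually.of_forall fun h => ?_)
  beta_reduce
  rw [← Polynomial.coe_evalRingHom, RingHom.map_det]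
  congr 1
  ext i j
  by_cases hij : i = j <;> simp [hij, mul_comm h (M _ _)]

lemma hasDerivAt_det_one_sub_smul {M R : Matrix ι ι ℝ} {t : ℝ} (hR : (1 - t • M) * R = 1) :
    HasDerivAt (fun t : ℝ => (1 - t • M).det) (-((1 - t • M).det * (R * M).trace)) t := by
  have h1 := hasDerivAt_det_one_add_smul (-(R * M))
  have h2 : HasDerivAt (fun u : ℝ => u - t) 1 t := (hasDerivAt_id t).sub_const t
  have h3 := (HasDerivAt.comp_of_eq t h1 h2 (by simp)).const_mul (1 - t • M).det
  convert! h3 using 1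
  · funext u
    simp only [Function.comp]
    rw [← Matrix.det_mul, Matrix.mul_add, Matrix.mul_one, smul_neg, Matrix.mul_neg,
      Matrix.mul_smul, ← Matrix.mul_assoc, hR, Matrix.one_mul, sub_smul]
    congr 1
    abel
  · simp [Matrix.trace_neg]

lemma summable_trace_pow_succ {M : Matrix ι ι ℝ}
    (h : ∀ i j, Summable fun k : ℕ => |(M ^ k) i j|) :
    Summable fun k : ℕ => |(M ^ (k + 1)).trace| := by
  refine Summable.of_nonneg_of_le (fun _ => abs_nonneg _)
    (fun k => Finset.abs_sum_le_sum_abs _ _) ?_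
  exact summable_sum fun i _ => (summable_nat_add_iff 1).2 (h i i)

/-- If the powers of `M` are summable, then `log det (1 - M) = -∑ tr (M ^ (m + 1)) / (m + 1)`.
The function `t ↦ det (1 - t M) * exp (∑ t ^ (m + 1) tr (M ^ (m + 1)) / (m + 1))` has derivative
zero on `[0, 1)`. -/
theorem det_one_sub_eq_exp {M : Matrix ι ι ℝ}
    (h : ∀ i j, Summable fun k : ℕ => |(M ^ k) i j|) :
    (1 - M).det = Real.exp (-∑' m : ℕ, (M ^ (m + 1)).trace / (m + 1)) := by
  have htr := summable_trace_pow_succ h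
  set g : ℕ → ℝ → ℝ := fun m t => (M ^ (m + 1)).trace / (m + 1) * t ^ (m + 1) with hg
  have hgb : ∀ m, ∀ t ∈ Set.Icc (0 : ℝ) 1, ‖g m t‖ ≤ |(M ^ (m + 1)).trace| := by
    intro m t ht
    rw [hg, Real.norm_eq_abs, abs_mul, abs_div, abs_pow, abs_of_nonneg ht.1,
      abs_of_pos (by positivity : (0 : ℝ) < m + 1)]
    refine (mul_le_of_le_one_right (by positivity) (pow_le_one₀ ht.1 ht.2)).trans ?_
    exact div_le_self (abs_nonneg _) (by linarith [Nat.cast_nonneg (α := ℝ) m])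
  have hgc : ContinuousOn (fun t => ∑' m, g m t) (Set.Icc 0 1) :=
    continuousOn_tsum (fun m => by fun_prop) htr hgb
  have hconst := constant_of_has_deriv_right_zero (a := (0 : ℝ)) (b := 1)
    (f := fun t => (1 - t • M).det * Real.exp (∑' m, g m t)) ?_ ?_ 1 (by simp)
  · have h0 : ∑' m, g m 0 = 0 := by simp [hg]
    simp only [h0, zero_smul, sub_zero, Matrix.det_one, Real.exp_zero, mul_one, one_smul] at hconst
    rw [Real.exp_neg, eq_inv_of_mul_eq_one_left hconst]
    simp [hg]
  · refine ContinuousOn.mul ?_ (Real.continuous_exp.comp_continuousOn hgc)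
    exact (Continuous.matrix_det (by fun_prop)).continuousOn
  · intro t ht
    have hs : Summable fun k : ℕ => (t • M) ^ k := by
      refine Pi.summable.2 fun i => Pi.summable.2 fun j => ?_
      refine Summable.of_norm_bounded (h i j) fun k => ?_
      rw [smul_pow, Matrix.smul_apply, smul_eq_mul, norm_mul, norm_pow, Real.norm_eq_abs,
        Real.norm_eq_abs, abs_of_nonneg ht.1]
      exact mul_le_of_le_one_left (abs_nonneg _) (pow_le_one₀ ht.1 ht.2.le)
    have hd := hasDerivAt_det_one_sub_smul (M := M) (t := t) hs.one_sub_mul_tsum_pow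
    have hsum : HasSum (fun k : ℕ => (M ^ (k + 1)).trace * t ^ k)
        ((∑' k : ℕ, (t • M) ^ k) * M).trace := by
      have := (hs.hasSum.mul_right M).map (Matrix.traceAddMonoidHom ι ℝ)
        (Continuous.matrix_trace continuous_id)
      convert! this using 1
      funext k
      simp only [Function.comp, Matrix.traceAddMonoidHom_apply, smul_pow, Matrix.smul_mul,
        Matrix.trace_smul, pow_succ, smul_eq_mul]
      ring
    have hgd : HasDerivAt (fun t => ∑' m, g m t) (∑' m, (M ^ (m + 1)).trace * t ^ m) t := by
      refine hasDerivAt_tsum_of_isPreconnected (g := g)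
        (g' := fun m t => (M ^ (m + 1)).trace * t ^ m) (t := Set.Ioo (-1) 1) htr isOpen_Ioo
        isPreconnected_Ioo (fun m y _ => ?_) (fun m y hy => ?_) (y₀ := 0) (by simp)
        (by simp [hg]) ⟨by linarith [ht.1], ht.2⟩
      · have := (hasDerivAt_pow (m + 1) y).const_mul ((M ^ (m + 1)).trace / (m + 1))
        convert! this using 1
        have : ((m : ℝ) + 1) ≠ 0 := by positivity
        push_cast
        field_simp
      · rw [norm_mul, norm_pow, Real.norm_eq_abs, Real.norm_eq_abs]
        exact mul_le_of_le_one_right (abs_nonneg _)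
          (pow_le_one₀ (abs_nonneg _) (abs_le.2 ⟨hy.1.le, hy.2.le⟩))
    rw [hsum.tsum_eq] at hgd
    refine HasDerivAt.hasDerivWithinAt ?_
    convert! hd.mul hgd.exp using 1
    ring

end LogDet

/-! ### Laplace transforms of finite measures on the nonnegative orthant -/

section Laplace

open scoped NNReal ENNReal BoundedContinuousFunction

variable {ι : Type*} [Fintype ι]

/-- The exponential `x ↦ exp (-∑ sᵢ xᵢ)` on the nonnegative orthant. -/
noncomputable def expNegDot (s x : ι → ℝ≥0) : ℝ := Real.exp (-∑ i, (s i : ℝ) * x i)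

/-- `F` is the Laplace transform of a finite measure on the nonnegative orthant. -/
def IsLaplace (F : (ι → ℝ≥0) → ℝ) : Prop :=
  ∃ ν : Measure (ι → ℝ≥0), IsFiniteMeasure ν ∧ ∀ s, ∫ x, expNegDot s x ∂ν = F s

lemma expNegDot_pos (s x : ι → ℝ≥0) : 0 < expNegDot s x := Real.exp_pos _

lemma expNegDot_le_one (s x : ι → ℝ≥0) : expNegDot s x ≤ 1 :=
  Real.exp_le_one_iff.2 (neg_nonpos.2 (Finset.sum_nonneg fun _ _ => by positivity))

@[simp] lemma expNegDot_zero (x : ι → ℝ≥0) : expNegDot 0 x = 1 := by simp [expNegDot]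

lemma expNegDot_add_left (s t x : ι → ℝ≥0) :
    expNegDot (s + t) x = expNegDot s x * expNegDot t x := by
  simp only [expNegDot, ← Real.exp_add, ← neg_add, ← Finset.sum_add_distrib]
  simp [add_mul]

lemma expNegDot_add_right (s x y : ι → ℝ≥0) :
    expNegDot s (x + y) = expNegDot s x * expNegDot s y := by
  simp only [expNegDot, ← Real.exp_add, ← neg_add, ← Finset.sum_add_distrib]
  simp [mul_add]

lemma expNegDot_comm (s x : ι → ℝ≥0) : expNegDot s x = expNegDot x s := by
  simp only [expNegDot, mul_comm]

lemma expNegDot_single_left [DecidableEq ι] (i : ι) (a : ℝ≥0) (x : ι → ℝ≥0) :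
    expNegDot (Pi.single i a) x = Real.exp (-(a * x i)) := by
  rw [expNegDot, Finset.sum_eq_single i (fun j _ hj => by simp [hj]) (by simp)]
  simp

lemma continuous_expNegDot (s : ι → ℝ≥0) : Continuous (expNegDot s) := by
  unfold expNegDot; fun_prop

/-- `expNegDot s` as a bounded continuous function. -/
noncomputable def expNegDotBCF (s : ι → ℝ≥0) : (ι → ℝ≥0) →ᵇ ℝ :=
  BoundedContinuousFunction.ofNormedAddCommGroup (expNegDot s) (continuous_expNegDot s) 1
    fun x => by
      rw [Real.norm_eq_abs, abs_of_pos (expNegDot_pos s x)]; exact expNegDot_le_one s x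

lemma integrable_expNegDot (ν : Measure (ι → ℝ≥0)) [IsFiniteMeasure ν] (s : ι → ℝ≥0) :
    Integrable (expNegDot s) ν :=
  (expNegDotBCF s).integrable ν

/-- A finite measure on the nonnegative orthant is determined by its Laplace transform: the
exponentials span an algebra that separates points. -/
theorem ext_of_integral_expNegDot {μ ν : Measure (ι → ℝ≥0)} [IsFiniteMeasure μ]
    [IsFiniteMeasure ν] (h : ∀ s, ∫ x, expNegDot s x ∂μ = ∫ x, expNegDot s x ∂ν) : μ = ν := by
  classical
  let S : Submonoid ((ι → ℝ≥0) →ᵇ ℝ) :=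
    { carrier := Set.range expNegDotBCF
      one_mem' := ⟨0, by ext x; simp [expNegDotBCF]⟩
      mul_mem' := by
        rintro _ _ ⟨s, rfl⟩ ⟨t, rfl⟩
        exact ⟨s + t, by ext x; simp [expNegDotBCF, expNegDot_add_left]⟩ }
  let A : StarSubalgebra ℝ ((ι → ℝ≥0) →ᵇ ℝ) :=
    { Algebra.adjoin ℝ (S : Set ((ι → ℝ≥0) →ᵇ ℝ)) with
      star_mem' := fun {f} hf => by
        have : star f = f := by ext x; simp
        rwa [this] }
  refine ext_of_forall_mem_subalgebra_integral_eq_of_pseudoEMetric_complete_countable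
    (A := A) ?_ ?_
  · intro x y hxy
    obtain ⟨i, hi⟩ := Function.ne_iff.1 hxy
    refine ⟨expNegDot (Pi.single i 1), ⟨(expNegDotBCF (Pi.single i 1)).toContinuousMap,
      ⟨expNegDotBCF (Pi.single i 1), Algebra.subset_adjoin ⟨_, rfl⟩, rfl⟩, rfl⟩, ?_⟩
    simpa [expNegDot_single_left] using hi
  · intro g hg
    have hspan : Subalgebra.toSubmodule (Algebra.adjoin ℝ (S : Set ((ι → ℝ≥0) →ᵇ ℝ))) =
        Submodule.span ℝ (S : Set ((ι → ℝ≥0) →ᵇ ℝ)) := by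
      rw [Algebra.adjoin_eq_span, Submonoid.closure_eq]
    have hS : ∀ {f}, f ∈ Submodule.span ℝ (S : Set ((ι → ℝ≥0) →ᵇ ℝ)) → f ∈ A := by
      intro f hf
      rw [← hspan] at hf
      exact hf
    have hg' : g ∈ Submodule.span ℝ (S : Set ((ι → ℝ≥0) →ᵇ ℝ)) := by
      rw [← hspan]; exact hg
    induction hg' using Submodule.span_induction with
    | mem f hf => obtain ⟨s, rfl⟩ := hf; exact h s
    | zero => simp
    | add f g hf' hg₁ hf hg₂ =>
      simp only [BoundedContinuousFunction.coe_add, Pi.add_apply]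
      rw [integral_add (f.integrable μ) (g.integrable μ),
        integral_add (f.integrable ν) (g.integrable ν), hf (hS hf'), hg₂ (hS hg₁)]
    | smul c f hf' hf =>
      simp only [BoundedContinuousFunction.coe_smul, integral_smul, hf (hS hf')]

namespace IsLaplace

variable {F G : (ι → ℝ≥0) → ℝ}

lemma nonneg (hF : IsLaplace F) (s : ι → ℝ≥0) : 0 ≤ F s := by
  obtain ⟨ν, hν, h⟩ := hF
  rw [← h]
  exact integral_nonneg fun x => (expNegDot_pos s x).le

lemma le_zero (hF : IsLaplace F) (s : ι → ℝ≥0) : F s ≤ F 0 := by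
  obtain ⟨ν, hν, h⟩ := hF
  rw [← h, ← h]
  refine integral_mono (integrable_expNegDot ν s) (integrable_expNegDot ν 0) fun x => ?_
  simpa using expNegDot_le_one s x

lemma zero : IsLaplace (fun _ : ι → ℝ≥0 => (0 : ℝ)) := ⟨0, inferInstance, fun s => by simp⟩

lemma one : IsLaplace (fun _ : ι → ℝ≥0 => (1 : ℝ)) :=
  ⟨Measure.dirac 0, inferInstance, fun s => by simp [expNegDot]⟩

lemma const_mul (hF : IsLaplace F) {c : ℝ} (hc : 0 ≤ c) : IsLaplace fun s => c * F s := by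
  obtain ⟨ν, hν, h⟩ := hF
  refine ⟨c.toNNReal • ν, inferInstance, fun s => ?_⟩
  rw [integral_smul_nnreal_measure, h, NNReal.smul_def, Real.coe_toNNReal c hc, smul_eq_mul]

lemma add (hF : IsLaplace F) (hG : IsLaplace G) : IsLaplace fun s => F s + G s := by
  obtain ⟨μ, hμ, h⟩ := hF
  obtain ⟨ν, hν, h'⟩ := hG
  refine ⟨μ + ν, inferInstance, fun s => ?_⟩
  rw [integral_add_measure (integrable_expNegDot μ s) (integrable_expNegDot ν s), h, h']

lemma sum {κ : Type*} (T : Finset κ) {F : κ → (ι → ℝ≥0) → ℝ} (hF : ∀ k ∈ T, IsLaplace (F k)) :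
    IsLaplace fun s => ∑ k ∈ T, F k s := by
  classical
  induction T using Finset.induction_on with
  | empty => simpa using zero
  | insert a T ha ih =>
    simp only [Finset.sum_insert ha]
    exact (hF a (by simp)).add (ih fun k hk => hF k (by simp [hk]))

/-- A product of Laplace transforms is the Laplace transform of the convolution. -/
lemma mul (hF : IsLaplace F) (hG : IsLaplace G) : IsLaplace fun s => F s * G s := by
  obtain ⟨μ, hμ, h⟩ := hF
  obtain ⟨ν, hν, h'⟩ := hG
  refine ⟨(μ.prod ν).map fun p => p.1 + p.2, inferInstance, fun s => ?_⟩
  rw [integral_map (by fun_prop) (continuous_expNegDot s).aestronglyMeasurable]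
  simp only [expNegDot_add_right]
  rw [integral_prod_mul, h, h']

lemma pow (hF : IsLaplace F) (k : ℕ) : IsLaplace fun s => F s ^ k := by
  induction k with
  | zero => simpa using one
  | succ k ih => simpa only [pow_succ] using ih.mul hF

lemma prod {κ : Type*} (T : Finset κ) {F : κ → (ι → ℝ≥0) → ℝ} (hF : ∀ k ∈ T, IsLaplace (F k)) :
    IsLaplace fun s => ∏ k ∈ T, F k s := by
  classical
  induction T using Finset.induction_on with
  | empty => simpa using one
  | insert a T ha ih =>
    simp only [Finset.prod_insert ha]
    exact (hF a (by simp)).mul (ih fun k hk => hF k (by simp [hk]))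

lemma hasSum {F : ℕ → (ι → ℝ≥0) → ℝ} (hF : ∀ k, IsLaplace (F k))
    (h : ∀ s, HasSum (fun k => F k s) (G s)) : IsLaplace G := by
  choose ν hν hF' using hF
  have hmass : ∀ k, ν k Set.univ = ENNReal.ofReal (F k 0) := by
    intro k
    have := hF' k 0
    simp only [expNegDot_zero, integral_const, smul_eq_mul, mul_one] at this
    rw [← this, measureReal_def, ENNReal.ofReal_toReal (measure_ne_top _ _)]
  have hfin : IsFiniteMeasure (Measure.sum ν) := by
    refine ⟨?_⟩
    rw [Measure.sum_apply _ MeasurableSet.univ]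
    simp only [hmass]
    rw [← ENNReal.ofReal_tsum_of_nonneg (fun k => ?_) (h 0).summable]
    · exact ENNReal.ofReal_lt_top
    · rw [← hF' k 0]
      exact integral_nonneg fun x => (expNegDot_pos 0 x).le
  refine ⟨Measure.sum ν, hfin, fun s => ?_⟩
  have h1 := hasSum_integral_measure (integrable_expNegDot (Measure.sum ν) s)
  simp only [hF'] at h1
  exact h1.unique (h s)

lemma exp_sub_one (hF : IsLaplace F) : IsLaplace fun s => Real.exp (F s) - 1 := by
  refine hasSum (F := fun k s => ((k + 1).factorial : ℝ)⁻¹ * F s ^ (k + 1))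
    (fun k => (hF.pow _).const_mul (by positivity)) fun s => ?_
  have h := NormedSpace.expSeries_div_hasSum_exp (𝔸 := ℝ) (F s)
  rw [← Real.exp_eq_exp_ℝ] at h
  have h2 := (hasSum_nat_add_iff' 1).2 h
  simpa [div_eq_inv_mul] using h2

lemma exp (hF : IsLaplace F) : IsLaplace fun s => Real.exp (F s) := by
  simpa using hF.exp_sub_one.add one

/-- The Laplace transform of a gamma measure placed on the `i`-th coordinate axis. -/
lemma gamma (i : ι) {d β : ℝ} (hd : 0 < d) (hβ : 0 < β) :
    IsLaplace fun s : ι → ℝ≥0 => (1 / (d + s i)) ^ β := by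
  classical
  have key : ∀ r : ℝ, 0 ≤ r →
      ∫ t in Set.Ioi (0 : ℝ), (t ^ (β - 1) * Real.exp (-(d * t)) / Real.Gamma β)
        * Real.exp (-(r * t)) = (1 / (d + r)) ^ β := by
    intro r hr
    have h := Real.integral_rpow_mul_exp_neg_mul_Ioi hβ (by positivity : 0 < d + r)
    have hG := (Real.Gamma_pos_of_pos hβ).ne'
    rw [← mul_div_cancel_right₀ ((1 / (d + r)) ^ β) hG, ← h, ← integral_div]
    congr 1
    funext t
    rw [add_mul, neg_add, Real.exp_add]
    ring
  set f : ℝ → ℝ := fun t => t ^ (β - 1) * Real.exp (-(d * t)) / Real.Gamma β with hf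
  have hfm : Measurable f := by fun_prop
  have hf0 : ∀ᵐ t ∂(volume.restrict (Set.Ioi (0 : ℝ))), 0 ≤ f t := by
    filter_upwards [ae_restrict_mem measurableSet_Ioi] with t ht
    have := Real.Gamma_pos_of_pos hβ
    have := Real.rpow_nonneg (le_of_lt ht) (β - 1)
    positivity
  have hfi : Integrable f (volume.restrict (Set.Ioi 0)) := by
    by_contra hcon
    have h0 := key 0 le_rfl
    simp only [zero_mul, neg_zero, Real.exp_zero, mul_one, add_zero] at h0
    rw [integral_undef hcon] at h0
    exact (Real.rpow_pos_of_pos (one_div_pos.2 hd) β).ne h0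
  let ρ : Measure ℝ := (volume.restrict (Set.Ioi 0)).withDensity fun t => ENNReal.ofReal (f t)
  have hρ : IsFiniteMeasure ρ := isFiniteMeasure_withDensity_ofReal hfi.2
  have hm : Measurable fun t : ℝ => (Pi.single i t.toNNReal : ι → ℝ≥0) :=
    (measurable_pi_iff.2 fun j => by
      by_cases hj : j = i
      · subst hj; simpa using measurable_real_toNNReal
      · simp [hj])
  refine ⟨ρ.map fun t => Pi.single i t.toNNReal, inferInstance, fun s => ?_⟩
  beta_reduce
  rw [integral_map hm.aemeasurable (continuous_expNegDot s).aestronglyMeasurable,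
    ← key (s i) (s i).2]
  change ∫ t, _ ∂(Measure.withDensity _ _) = _
  rw [integral_withDensity_eq_integral_toReal_smul (by fun_prop) (by simp)]
  refine integral_congr_ae ?_
  filter_upwards [hf0, ae_restrict_mem measurableSet_Ioi] with t ht ht'
  rw [ENNReal.toReal_ofReal ht, smul_eq_mul]
  congr 1
  simp [expNegDot_comm s, expNegDot_single_left, mul_comm, (le_of_lt ht' : (0 : ℝ) ≤ t)]

end IsLaplace

end Laplace

/-! ### Nonsingular M-matrices and closed walks -/

section MMatrix

open Matrix
open scoped NNReal

variable {n : ℕ}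

namespace IsNonsingularMMatrix

variable {A : Matrix (Fin n) (Fin n) ℝ}

lemma mul_inv_cancel (hA : IsNonsingularMMatrix A) : A * A⁻¹ = 1 :=
  Matrix.mul_nonsing_inv _ (isUnit_iff_ne_zero.2 hA.det_ne_zero)

lemma diag_pos (hA : IsNonsingularMMatrix A) (i : Fin n) : 0 < A i i := by
  have h : (A * A⁻¹) i i = 1 := by rw [hA.mul_inv_cancel, Matrix.one_apply_eq]
  rw [Matrix.mul_apply, ← Finset.add_sum_erase _ _ (Finset.mem_univ i)] at h
  have h2 : ∑ j ∈ Finset.univ.erase i, A i j * A⁻¹ j i ≤ 0 :=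
    Finset.sum_nonpos fun j hj => mul_nonpos_of_nonpos_of_nonneg
      (hA.offDiag_nonpos i j (Finset.ne_of_mem_erase hj).symm) (hA.inv_nonneg j i)
  exact pos_of_mul_pos_left (by linarith : 0 < A i i * A⁻¹ i i) (hA.inv_nonneg i i)

lemma transpose (hA : IsNonsingularMMatrix A) : IsNonsingularMMatrix Aᵀ where
  offDiag_nonpos i j hij := hA.offDiag_nonpos j i hij.symm
  det_ne_zero := by rw [Matrix.det_transpose]; exact hA.det_ne_zero
  inv_nonneg i j := by rw [← Matrix.transpose_nonsing_inv]; exact hA.inv_nonneg j i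

lemma offDiagPart_nonneg (hA : IsNonsingularMMatrix A) (i j : Fin n) :
    0 ≤ offDiagPart A i j := by
  by_cases h : i = j
  · simp [offDiagPart, diagPart, h]
  · simpa [offDiagPart, diagPart, h] using hA.offDiag_nonpos i j h

end IsNonsingularMMatrix

/-- If `1 - M` has an entrywise nonnegative right inverse `R`, the partial sums of `∑ M ^ k` are
bounded by `R`. -/
lemma summable_pow_apply_of_nonneg {M R : Matrix (Fin n) (Fin n) ℝ} (hM : ∀ i j, 0 ≤ M i j)
    (hR : ∀ i j, 0 ≤ R i j) (h : (1 - M) * R = 1) (i j : Fin n) :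
    Summable fun k : ℕ => (M ^ k) i j := by
  refine summable_of_sum_range_le (c := R i j) (fun k => pow_apply_nonneg hM k i j) fun m => ?_
  have h1 : ∑ k ∈ Finset.range m, M ^ k = R - M ^ m * R := by
    rw [← Matrix.mul_one (∑ k ∈ Finset.range m, M ^ k), ← h, ← Matrix.mul_assoc,
      geom_sum_mul_neg, Matrix.sub_mul, Matrix.one_mul]
  have h2 : 0 ≤ (M ^ m * R) i j := by
    rw [Matrix.mul_apply]
    exact Finset.sum_nonneg fun l _ => mul_nonneg (pow_apply_nonneg hM m i l) (hR l j)
  have h3 := congrFun (congrFun h1 i) j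
  rw [Matrix.sum_apply, Matrix.sub_apply] at h3
  linarith

/-- The reciprocals `1 / (dᵢ + sᵢ)`, the diagonal of `(D + S)⁻¹`. -/
noncomputable def recipDiag (d : Fin n → ℝ) (s : Fin n → ℝ≥0) (i : Fin n) : ℝ :=
  1 / (d i + s i)

lemma isLaplace_recipDiag {d : Fin n → ℝ} (hd : ∀ i, 0 < d i) (i : Fin n) :
    IsLaplace fun s => recipDiag d s i := by
  simpa [recipDiag] using IsLaplace.gamma i (hd i) one_pos

lemma diagonal_sub_eq_mul {d : Fin n → ℝ} (hd : ∀ i, 0 < d i) (C : Matrix (Fin n) (Fin n) ℝ)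
    (s : Fin n → ℝ≥0) :
    diagonal d - C + diagonal (fun i => (s i : ℝ)) =
      diagonal (fun i => d i + s i) * (1 - diagonal (recipDiag d s) * C) := by
  have h : (fun i => (d i + s i) * recipDiag d s i) = fun _ => 1 := by
    funext i
    have : d i + (s i : ℝ) ≠ 0 := (add_pos_of_pos_of_nonneg (hd i) (s i).2).ne'
    simp [recipDiag, this]
  rw [Matrix.mul_sub, ← Matrix.mul_assoc, Matrix.diagonal_mul_diagonal, h, Matrix.diagonal_one,
    Matrix.one_mul, Matrix.mul_one, ← Matrix.diagonal_add]
  abel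

/-- Expansion of the powers of `Z C`, `Z Cᵀ` and `Z S(C)` over walks from `i` to `j`. A walk `w`
contributes a common Laplace transform `h w`, the product of the `z`'s along `w`, with coefficient
the product `f w` of the entries of `C` along `w`, the product `g w` of the entries of `Cᵀ`, or
their geometric mean. -/
theorem exists_walk_expansion {C : Matrix (Fin n) (Fin n) ℝ} (hC : ∀ i j, 0 ≤ C i j)
    {z : (Fin n → ℝ≥0) → Fin n → ℝ} (hz : ∀ i, IsLaplace fun s => z s i) (m : ℕ) (i j : Fin n) :
    ∃ (κ : Type) (_ : Fintype κ) (f g : κ → ℝ) (h : κ → (Fin n → ℝ≥0) → ℝ),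
      (∀ w, 0 ≤ f w) ∧ (∀ w, 0 ≤ g w) ∧ (∀ w, IsLaplace (h w)) ∧ ∀ s,
        ((diagonal (z s) * C) ^ m) i j = ∑ w, f w * h w s ∧
        ((diagonal (z s) * Cᵀ) ^ m) i j = ∑ w, g w * h w s ∧
        ((diagonal (z s) * geomSymm C) ^ m) i j = ∑ w, √(f w * g w) * h w s := by
  induction m generalizing i j with
  | zero =>
    refine ⟨Unit, inferInstance, fun _ => if i = j then 1 else 0, fun _ => if i = j then 1 else 0,
      fun _ _ => 1, fun _ => ?_, fun _ => ?_, fun _ => IsLaplace.one, fun s => ?_⟩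
    · split <;> norm_num
    · split <;> norm_num
    · by_cases hij : i = j <;> simp [hij]
  | succ m ih =>
    choose κ hκ f g h hf hg hh e using fun l => ih i l
    refine ⟨Σ l, κ l, inferInstance, fun w => f w.1 w.2 * C w.1 j, fun w => g w.1 w.2 * C j w.1,
      fun w s => h w.1 w.2 s * z s w.1, fun w => mul_nonneg (hf _ _) (hC _ _),
      fun w => mul_nonneg (hg _ _) (hC _ _), fun w => (hh _ _).mul (hz _), fun s => ?_⟩
    have step : ∀ K : Matrix (Fin n) (Fin n) ℝ, ((diagonal (z s) * K) ^ (m + 1)) i j =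
        ∑ l, ((diagonal (z s) * K) ^ m) i l * (z s l * K l j) := fun K => by
      rw [pow_succ, Matrix.mul_apply]
      simp only [Matrix.diagonal_mul]
    simp only [step, Fintype.sum_sigma, (e _ s).1, (e _ s).2.1, (e _ s).2.2, Finset.sum_mul,
      Matrix.transpose_apply]
    refine ⟨?_, ?_, ?_⟩
    · exact Finset.sum_congr rfl fun l _ => Finset.sum_congr rfl fun w _ => by ring
    · exact Finset.sum_congr rfl fun l _ => Finset.sum_congr rfl fun w _ => by ring
    · refine Finset.sum_congr rfl fun l _ => Finset.sum_congr rfl fun w _ => ?_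
      rw [mul_mul_mul_comm (f l w), Real.sqrt_mul (mul_nonneg (hf _ _) (hg _ _))]
      simp only [geomSymm, Matrix.of_apply]
      ring

lemma geomSymm_nonneg (C : Matrix (Fin n) (Fin n) ℝ) (i j : Fin n) : 0 ≤ geomSymm C i j :=
  Real.sqrt_nonneg _

section Walks

variable {C : Matrix (Fin n) (Fin n) ℝ} {z : (Fin n → ℝ≥0) → Fin n → ℝ}

lemma isLaplace_pow_apply (hC : ∀ i j, 0 ≤ C i j) (hz : ∀ i, IsLaplace fun s => z s i) (m : ℕ)
    (i j : Fin n) : IsLaplace fun s => ((diagonal (z s) * C) ^ m) i j := by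
  obtain ⟨κ, _, f, g, h, hf, -, hh, e⟩ := exists_walk_expansion hC hz m i j
  simp only [(e _).1]
  exact IsLaplace.sum _ fun w _ => (hh w).const_mul (hf w)

/-- The arithmetic mean exceeds the geometric mean on each walk:
`f + g - 2 √(f g) = (√f - √g) ^ 2`. -/
lemma isLaplace_pow_apply_sub (hC : ∀ i j, 0 ≤ C i j) (hz : ∀ i, IsLaplace fun s => z s i)
    (m : ℕ) (i j : Fin n) :
    IsLaplace fun s => ((diagonal (z s) * C) ^ m) i j + ((diagonal (z s) * Cᵀ) ^ m) i j -
      2 * ((diagonal (z s) * geomSymm C) ^ m) i j := by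
  obtain ⟨κ, _, f, g, h, hf, hg, hh, e⟩ := exists_walk_expansion hC hz m i j
  simp only [(e _).1, (e _).2.1, (e _).2.2, Finset.mul_sum, ← Finset.sum_add_distrib,
    ← Finset.sum_sub_distrib]
  refine IsLaplace.sum _ fun w _ => ?_
  convert! (hh w).const_mul (sq_nonneg (√(f w) - √(g w))) using 1
  funext s
  rw [Real.sqrt_mul (hf w), sub_sq, Real.sq_sqrt (hf w), Real.sq_sqrt (hg w)]
  ring

end Walks

/-- The series `∑ tr (M ^ (m + 1)) / (m + 1)`, which represents `-log det (1 - M)`. -/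
noncomputable def traceLogSeries (M : Matrix (Fin n) (Fin n) ℝ) : ℝ :=
  ∑' m : ℕ, (M ^ (m + 1)).trace / (m + 1)

lemma hasSum_traceLogSeries {M : Matrix (Fin n) (Fin n) ℝ}
    (h : ∀ i j, Summable fun k : ℕ => |(M ^ k) i j|) :
    HasSum (fun m : ℕ => (M ^ (m + 1)).trace / (m + 1)) (traceLogSeries M) := by
  refine Summable.hasSum (Summable.of_norm_bounded (summable_trace_pow_succ h) fun m => ?_)
  rw [Real.norm_eq_abs, abs_div, abs_of_pos (by positivity : (0 : ℝ) < m + 1)]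
  exact div_le_self (abs_nonneg _) (by linarith [Nat.cast_nonneg (α := ℝ) m])

lemma isLaplace_traceLogSeries {C : Matrix (Fin n) (Fin n) ℝ} {z : (Fin n → ℝ≥0) → Fin n → ℝ}
    (hC : ∀ i j, 0 ≤ C i j) (hz : ∀ i, IsLaplace fun s => z s i)
    (h : ∀ s i j, Summable fun k : ℕ => |((diagonal (z s) * C) ^ k) i j|) :
    IsLaplace fun s => traceLogSeries (diagonal (z s) * C) := by
  refine IsLaplace.hasSum (fun m => ?_) fun s => hasSum_traceLogSeries (h s)
  simp only [div_eq_inv_mul]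
  exact (IsLaplace.sum _ fun i _ => isLaplace_pow_apply hC hz (m + 1) i i).const_mul
    (by positivity)

namespace IsNonsingularMMatrix

variable {A : Matrix (Fin n) (Fin n) ℝ}

/-- At `s = 0` this is the Neumann series of `A⁻¹ D`; for other `s` the entries are smaller. -/
lemma summable_pow (hA : IsNonsingularMMatrix A) (s : Fin n → ℝ≥0) (i j : Fin n) :
    Summable fun k : ℕ =>
      |((diagonal (recipDiag (fun i => A i i) s) * offDiagPart A) ^ k) i j| := by
  have hL := fun k => isLaplace_pow_apply hA.offDiagPart_nonneg
    (isLaplace_recipDiag hA.diag_pos) k i j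
  simp only [abs_of_nonneg ((hL _).nonneg s)]
  refine Summable.of_nonneg_of_le (fun k => (hL k).nonneg s) (fun k => (hL k).le_zero s) ?_
  refine summable_pow_apply_of_nonneg (R := A⁻¹ * diagPart A) (fun i j => ?_) (fun i j => ?_) ?_ i j
  · rw [Matrix.diagonal_mul]
    exact mul_nonneg ((isLaplace_recipDiag hA.diag_pos i).nonneg 0) (hA.offDiagPart_nonneg i j)
  · rw [diagPart, Matrix.mul_diagonal]
    exact mul_nonneg (hA.inv_nonneg i j) (hA.diag_pos j).le
  · have h := diagonal_sub_eq_mul hA.diag_pos (offDiagPart A) 0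
    have hA' : diagonal (fun i => A i i) - offDiagPart A = A := by
      simp [offDiagPart, diagPart]
    simp only [hA', Pi.zero_apply, NNReal.coe_zero, add_zero, Matrix.diagonal_zero] at h
    rw [← Matrix.mul_assoc]
    refine mul_eq_one_comm.1 ?_
    rw [diagPart, ← Matrix.mul_assoc, ← h]
    exact hA.mul_inv_cancel

lemma offDiagPart_transpose (A : Matrix (Fin n) (Fin n) ℝ) :
    offDiagPart Aᵀ = (offDiagPart A)ᵀ := by
  simp [offDiagPart, diagPart]

lemma summable_pow_transpose (hA : IsNonsingularMMatrix A) (s : Fin n → ℝ≥0) (i j : Fin n) :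
    Summable fun k : ℕ =>
      |((diagonal (recipDiag (fun i => A i i) s) * (offDiagPart A)ᵀ) ^ k) i j| := by
  simpa [offDiagPart_transpose] using hA.transpose.summable_pow s i j

lemma summable_pow_geomSymm (hA : IsNonsingularMMatrix A) (s : Fin n → ℝ≥0) (i j : Fin n) :
    Summable fun k : ℕ =>
      |((diagonal (recipDiag (fun i => A i i) s) * geomSymm (offDiagPart A)) ^ k) i j| := by
  have hz := isLaplace_recipDiag hA.diag_pos
  refine Summable.of_nonneg_of_le (fun _ => abs_nonneg _) (fun k => ?_)
    ((hA.summable_pow s i j).add (hA.summable_pow_transpose s i j))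
  have h1 := (isLaplace_pow_apply (geomSymm_nonneg (offDiagPart A)) hz k i j).nonneg s
  have h2 := (isLaplace_pow_apply_sub hA.offDiagPart_nonneg hz k i j).nonneg s
  rw [abs_of_nonneg h1]
  refine le_trans ?_ (add_le_add (le_abs_self _) (le_abs_self _))
  linarith

end IsNonsingularMMatrix

end MMatrix

/-! ### Laws determined by their Laplace transform -/

section Transfer

open scoped NNReal

variable {ι : Type*} [Fintype ι] {Ω : Type*} [MeasurableSpace Ω] {P : Measure Ω}

/-- An exponential moment that stays bounded as `t → ∞` forces nonnegativity. -/
lemma ae_nonneg_of_integral_exp_neg_le [IsFiniteMeasure P] {Y : Ω → ℝ} {c : ℝ}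
    (hint : ∀ k : ℕ, Integrable (fun ω => Real.exp (-k * Y ω)) P)
    (hle : ∀ k : ℕ, ∫ ω, Real.exp (-k * Y ω) ∂P ≤ c) : ∀ᵐ ω ∂P, 0 ≤ Y ω := by
  have hδ : ∀ m : ℕ, ∀ᵐ ω ∂P, -(1 / ((m : ℝ) + 1)) < Y ω := by
    intro m
    set δ : ℝ := 1 / ((m : ℝ) + 1) with hδdef
    have hδ0 : 0 < δ := by positivity
    have hb : ∀ k : ℕ, P.real {ω | Y ω ≤ -δ} ≤ Real.exp (-(k * δ)) * c := by
      intro k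
      have h1 := ProbabilityTheory.measure_le_le_exp_mul_mgf (μ := P) (X := Y) (t := -(k : ℝ)) (-δ)
        (by simp) (hint k)
      refine h1.trans ?_
      rw [neg_neg, mul_neg]
      exact mul_le_mul_of_nonneg_left (hle k) (Real.exp_pos _).le
    have hlim : Filter.Tendsto (fun k : ℕ => Real.exp (-(k * δ)) * c) Filter.atTop (nhds 0) := by
      rw [← zero_mul c]
      refine Filter.Tendsto.mul_const c (Real.tendsto_exp_neg_atTop_nhds_zero.comp ?_)
      exact tendsto_natCast_atTop_atTop.atTop_mul_const hδ0
    have h0 : P.real {ω | Y ω ≤ -δ} = 0 :=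
      le_antisymm (ge_of_tendsto' hlim hb) measureReal_nonneg
    rw [measureReal_eq_zero_iff] at h0
    rw [ae_iff]
    simpa only [not_lt] using h0
  filter_upwards [ae_all_iff.2 hδ] with ω hω
  refine le_of_forall_pos_le_add fun ε hε => ?_
  obtain ⟨m, hm⟩ := exists_nat_one_div_lt hε
  linarith [hω m]

/-- A random vector whose exponential moments agree with the Laplace transform of a nonzero finite
measure `ν` on the nonnegative orthant has law `ν`; in particular it is almost surely
nonnegative. -/
theorem map_eq_of_integral_exp_eq [IsFiniteMeasure P] {X : Ω → ι → ℝ} (hX : AEMeasurable X P)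
    {ν : Measure (ι → ℝ≥0)} [IsFiniteMeasure ν] [NeZero ν]
    (h : ∀ s : ι → ℝ≥0,
      ∫ ω, Real.exp (-∑ i, (s i : ℝ) * X ω i) ∂P = ∫ x, expNegDot s x ∂ν) :
    P.map X = ν.map fun x i => (x i : ℝ) := by
  classical
  have hint : ∀ s : ι → ℝ≥0, Integrable (fun ω => Real.exp (-∑ i, (s i : ℝ) * X ω i)) P := by
    intro s
    -- The Bochner integral of a non-integrable function is zero.
    by_contra hcon
    have h1 := h s
    rw [integral_undef hcon] at h1
    exact (integral_exp_pos (integrable_expNegDot ν s)).ne h1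
  have hnn : ∀ᵐ ω ∂P, ∀ i, 0 ≤ X ω i := by
    refine ae_all_iff.2 fun i => ?_
    have hs : ∀ (k : ℕ) (ω : Ω), Real.exp (-∑ j, ((Pi.single i (k : ℝ≥0) : ι → ℝ≥0) j : ℝ) * X ω j)
        = Real.exp (-k * X ω i) := by
      intro k ω
      rw [Finset.sum_eq_single i (fun j _ hj => by simp [hj]) (by simp)]
      simp
    refine ae_nonneg_of_integral_exp_neg_le (c := ν.real Set.univ) (fun k => ?_) fun k => ?_
    · simpa only [hs] using hint (Pi.single i (k : ℝ≥0))
    · have h1 := h (Pi.single i (k : ℝ≥0))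
      simp only [hs] at h1
      rw [h1]
      refine (integral_mono (integrable_expNegDot ν _) (integrable_const 1)
        fun x => expNegDot_le_one _ x).trans ?_
      simp
  set Y : Ω → ι → ℝ≥0 := fun ω i => (X ω i).toNNReal with hYdef
  have hY : AEMeasurable Y P := by
    have : Measurable fun (x : ι → ℝ) (i : ι) => (x i).toNNReal := by fun_prop
    exact this.comp_aemeasurable hX
  have hXY : X =ᵐ[P] fun ω i => (Y ω i : ℝ) := by
    filter_upwards [hnn] with ω hω
    funext i
    exact (Real.coe_toNNReal _ (hω i)).symm
  have hlaw : P.map Y = ν := by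
    refine ext_of_integral_expNegDot fun s => ?_
    rw [integral_map hY (continuous_expNegDot s).aestronglyMeasurable, ← h s]
    refine integral_congr_ae ?_
    filter_upwards [hXY] with ω hω
    simp [expNegDot, hω]
  have hco : Measurable fun (x : ι → ℝ≥0) (i : ι) => (x i : ℝ) := by fun_prop
  rw [Measure.map_congr hXY, ← hlaw, AEMeasurable.map_map_of_aemeasurable hco.aemeasurable hY]
  rfl

end Transfer

/-! ### Comparison of the Laplace transforms of `X` and its symmetrization -/

section Permanental

open Matrix
open scoped NNReal

variable {n : ℕ}

section Formula

variable {d : Fin n → ℝ} {C : Matrix (Fin n) (Fin n) ℝ}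

lemma det_diagonal_sub_add (hd : ∀ i, 0 < d i)
    (h : ∀ s i j, Summable fun k : ℕ => |((diagonal (recipDiag d s) * C) ^ k) i j|)
    (s : Fin n → ℝ≥0) :
    (diagonal d - C + diagonal fun i => (s i : ℝ)).det =
      (∏ i, (d i + s i)) * Real.exp (-traceLogSeries (diagonal (recipDiag d s) * C)) := by
  rw [diagonal_sub_eq_mul hd, Matrix.det_mul, Matrix.det_diagonal, det_one_sub_eq_exp (h s)]
  rfl

lemma det_diagonal_sub_pos (hd : ∀ i, 0 < d i)
    (h : ∀ s i j, Summable fun k : ℕ => |((diagonal (recipDiag d s) * C) ^ k) i j|) :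
    0 < (diagonal d - C).det := by
  have h1 := det_diagonal_sub_add hd h 0
  simp only [Pi.zero_apply, NNReal.coe_zero, Matrix.diagonal_zero, add_zero] at h1
  rw [h1]
  exact mul_pos (Finset.prod_pos fun i _ => hd i) (Real.exp_pos _)

/-- The Laplace transform of an `α`-permanental vector with kernel `(D - C)⁻¹`, with the
determinant expanded as a series of traces. -/
lemma one_div_det_rpow_eq (hd : ∀ i, 0 < d i)
    (h : ∀ s i j, Summable fun k : ℕ => |((diagonal (recipDiag d s) * C) ^ k) i j|) (α : ℝ)
    (s : Fin n → ℝ≥0) :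
    1 / (1 + (diagonal d - C)⁻¹ * diagonal fun i => (s i : ℝ)).det ^ α =
      (diagonal d - C).det ^ α * ((∏ i, (1 / (d i + s i)) ^ α) *
        Real.exp (α * traceLogSeries (diagonal (recipDiag d s) * C))) := by
  have hpos := det_diagonal_sub_pos hd h
  set K := diagonal d - C
  have hds : ∀ i, 0 < d i + (s i : ℝ) := fun i => add_pos_of_pos_of_nonneg (hd i) (s i).2
  have h1 : (1 + K⁻¹ * diagonal fun i => (s i : ℝ)).det =
      (∏ i, (d i + s i)) * Real.exp (-traceLogSeries (diagonal (recipDiag d s) * C)) / K.det := by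
    rw [eq_div_iff hpos.ne', mul_comm, ← Matrix.det_mul, Matrix.mul_add, Matrix.mul_one,
      ← Matrix.mul_assoc, Matrix.mul_nonsing_inv _ (isUnit_iff_ne_zero.2 hpos.ne'),
      Matrix.one_mul, det_diagonal_sub_add hd h]
  have hp : 0 < ∏ i, (d i + (s i : ℝ)) := Finset.prod_pos fun i _ => hds i
  rw [h1, Real.div_rpow (mul_pos hp (Real.exp_pos _)).le hpos.le,
    Real.mul_rpow hp.le (Real.exp_pos _).le, ← Real.exp_mul,
    Real.finsetProd_rpow _ _ fun i _ => (one_div_pos.2 (hds i)).le, Finset.prod_div_distrib,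
    Finset.prod_const_one, Real.div_rpow zero_le_one hp.le, Real.one_rpow, neg_mul,
    Real.exp_neg, mul_comm α]
  field_simp

end Formula

variable {A : Matrix (Fin n) (Fin n) ℝ}

lemma eq_diagonal_sub_offDiagPart (A : Matrix (Fin n) (Fin n) ℝ) :
    A = diagonal (fun i => A i i) - offDiagPart A := by
  simp [offDiagPart, diagPart]

/-- `det (D + S - Bᵀ) = det (D + S - B)`. -/
lemma IsNonsingularMMatrix.traceLogSeries_transpose (hA : IsNonsingularMMatrix A)
    (s : Fin n → ℝ≥0) :
    traceLogSeries (diagonal (recipDiag (fun i => A i i) s) * (offDiagPart A)ᵀ) =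
      traceLogSeries (diagonal (recipDiag (fun i => A i i) s) * offDiagPart A) := by
  have h1 := det_diagonal_sub_add hA.diag_pos hA.summable_pow s
  have h2 := det_diagonal_sub_add hA.diag_pos hA.summable_pow_transpose s
  have hp : ∏ i, (A i i + (s i : ℝ)) ≠ 0 := Finset.prod_ne_zero_iff.2 fun i _ =>
    (add_pos_of_pos_of_nonneg (hA.diag_pos i) (s i).2).ne'
  rw [← Matrix.det_transpose] at h1
  simp only [Matrix.transpose_add, Matrix.transpose_sub, Matrix.diagonal_transpose] at h1
  rw [h1] at h2
  exact (neg_injective (Real.exp_injective (mul_left_cancel₀ hp h2))).symm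

/-- The trace series of `B` and of `Bᵀ` agree, so their average can be compared with that of
`S(B)` walk by walk. -/
lemma IsNonsingularMMatrix.isLaplace_traceLogSeries_sub (hA : IsNonsingularMMatrix A) :
    IsLaplace fun s =>
      traceLogSeries (diagonal (recipDiag (fun i => A i i) s) * offDiagPart A) -
        traceLogSeries (diagonal (recipDiag (fun i => A i i) s) * geomSymm (offDiagPart A)) := by
  have hz := isLaplace_recipDiag hA.diag_pos
  refine IsLaplace.hasSum (F := fun m s => (2 * ((m : ℝ) + 1))⁻¹ * ∑ i,
    (((diagonal (recipDiag (fun i => A i i) s) * offDiagPart A) ^ (m + 1)) i i +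
      ((diagonal (recipDiag (fun i => A i i) s) * (offDiagPart A)ᵀ) ^ (m + 1)) i i -
      2 * ((diagonal (recipDiag (fun i => A i i) s) * geomSymm (offDiagPart A)) ^ (m + 1)) i i))
    (fun m => ?_) fun s => ?_
  · exact (IsLaplace.sum _ fun i _ =>
      isLaplace_pow_apply_sub hA.offDiagPart_nonneg hz (m + 1) i i).const_mul (by positivity)
  · have h1 := hasSum_traceLogSeries (hA.summable_pow s)
    have h2 := hasSum_traceLogSeries (hA.summable_pow_transpose s)
    have h3 := hasSum_traceLogSeries (hA.summable_pow_geomSymm s)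
    rw [hA.traceLogSeries_transpose] at h2
    convert! ((h1.add h2).mul_left 2⁻¹).sub h3 using 1
    · funext m
      simp only [Finset.sum_sub_distrib, Finset.sum_add_distrib, ← Finset.mul_sum]
      simp only [Matrix.trace, Matrix.diag_apply]
      field_simp
    · ring

/-- The Laplace transform of the vector determined by `A_sym`. -/
lemma IsNonsingularMMatrix.isLaplace_symMatrix (hA : IsNonsingularMMatrix A) {α : ℝ}
    (hα : 0 < α) :
    IsLaplace fun s : Fin n → ℝ≥0 =>
      1 / (1 + (symMatrix A)⁻¹ * diagonal fun i => (s i : ℝ)).det ^ α := by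
  have hpos : 0 < (symMatrix A).det := det_diagonal_sub_pos hA.diag_pos hA.summable_pow_geomSymm
  have hG : IsLaplace fun s : Fin n → ℝ≥0 => ∏ i, (1 / (A i i + s i)) ^ α :=
    IsLaplace.prod _ fun i _ => IsLaplace.gamma i (hA.diag_pos i) hα
  have hQ := isLaplace_traceLogSeries (geomSymm_nonneg (offDiagPart A))
    (isLaplace_recipDiag hA.diag_pos) hA.summable_pow_geomSymm
  convert! (hG.mul (hQ.const_mul hα.le).exp).const_mul (Real.rpow_nonneg hpos.le α) using 1
  funext s
  exact one_div_det_rpow_eq hA.diag_pos hA.summable_pow_geomSymm α s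

/-- The Laplace transform of `X` exceeds `r = |A| ^ α / |A_sym| ^ α` times that of `X̃` by the
Laplace transform of a measure: with `Q` the trace series, the difference is
`|A| ^ α ∏ (dᵢ + sᵢ)⁻ᵅ exp (α Q_sym) (exp (α (Q - Q_sym)) - 1)`. -/
lemma IsNonsingularMMatrix.isLaplace_sub_symMatrix (hA : IsNonsingularMMatrix A) {α : ℝ}
    (hα : 0 < α) :
    IsLaplace fun s : Fin n → ℝ≥0 =>
      1 / (1 + A⁻¹ * diagonal fun i => (s i : ℝ)).det ^ α -
        A.det ^ α / (symMatrix A).det ^ α *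
          (1 / (1 + (symMatrix A)⁻¹ * diagonal fun i => (s i : ℝ)).det ^ α) := by
  have hpos : 0 < (symMatrix A).det := det_diagonal_sub_pos hA.diag_pos hA.summable_pow_geomSymm
  have hApos : 0 < A.det := by
    rw [eq_diagonal_sub_offDiagPart A]
    exact det_diagonal_sub_pos hA.diag_pos hA.summable_pow
  have hG : IsLaplace fun s : Fin n → ℝ≥0 => ∏ i, (1 / (A i i + s i)) ^ α :=
    IsLaplace.prod _ fun i _ => IsLaplace.gamma i (hA.diag_pos i) hα
  have hQ := isLaplace_traceLogSeries (geomSymm_nonneg (offDiagPart A))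
    (isLaplace_recipDiag hA.diag_pos) hA.summable_pow_geomSymm
  convert! ((hG.mul (hQ.const_mul hα.le).exp).mul
    (hA.isLaplace_traceLogSeries_sub.const_mul hα.le).exp_sub_one).const_mul
      (Real.rpow_nonneg hApos.le α) using 1
  funext s
  have h1 := one_div_det_rpow_eq hA.diag_pos hA.summable_pow α s
  rw [← eq_diagonal_sub_offDiagPart] at h1
  have h2 : 1 / (1 + (symMatrix A)⁻¹ * diagonal fun i => (s i : ℝ)).det ^ α =
      (symMatrix A).det ^ α * _ :=
    one_div_det_rpow_eq hA.diag_pos hA.summable_pow_geomSymm α s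
  have hne := (Real.rpow_pos_of_pos hpos α).ne'
  rw [h1, h2, mul_sub α, Real.exp_sub, ← mul_assoc (_ / _), div_mul_cancel₀ _ hne]
  have := (Real.exp_pos (α * traceLogSeries
    (diagonal (recipDiag (fun i => A i i) s) * geomSymm (offDiagPart A)))).ne'
  field_simp

end Permanental

theorem corollary3p6 {n : ℕ} (A : Matrix (Fin n) (Fin n) ℝ) (hA : IsNonsingularMMatrix A)
    (α : ℝ) (hα : 0 < α)
    {Ω : Type*} [MeasurableSpace Ω] (P : Measure Ω) [IsProbabilityMeasure P]
    {Ω' : Type*} [MeasurableSpace Ω'] (P' : Measure Ω') [IsProbabilityMeasure P']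
    (X : Ω → Fin n → ℝ) (hX : IsPermanentalDeterminedBy P α A X)
    (X' : Ω' → Fin n → ℝ) (hX' : IsPermanentalDeterminedBy P' α (symMatrix A) X')
    {E : Type*} (g : (Fin n → ℝ) → E) (B : Set E) (hgB : MeasurableSet (g ⁻¹' B)) :
    A.det ^ α / (symMatrix A).det ^ α * P'.real {ω | g (X' ω) ∈ B}
        ≤ P.real {ω | g (X ω) ∈ B} ∧
      P.real {ω | g (X ω) ∈ B}
        ≤ (1 - A.det ^ α / (symMatrix A).det ^ α)
          + A.det ^ α / (symMatrix A).det ^ α * P'.real {ω | g (X' ω) ∈ B} := by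
  set r := A.det ^ α / (symMatrix A).det ^ α with hr
  have hr0 : 0 ≤ r := by
    have h1 : 0 < (symMatrix A).det :=
      det_diagonal_sub_pos hA.diag_pos hA.summable_pow_geomSymm
    have h2 : 0 < A.det := by
      rw [eq_diagonal_sub_offDiagPart A]
      exact det_diagonal_sub_pos hA.diag_pos hA.summable_pow
    positivity
  obtain ⟨ν', hν', hL'⟩ := hA.isLaplace_symMatrix hα
  obtain ⟨ρ, hρ, hLρ⟩ := hA.isLaplace_sub_symMatrix hα
  have hXs := fun s : Fin n → NNReal => hX.laplace (fun i => s i) fun i => (s i).2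
  have hXs' := fun s : Fin n → NNReal => hX'.laplace (fun i => s i) fun i => (s i).2
  have hmass : ν'.real Set.univ = 1 := by
    simpa using hL' 0
  have hne' : NeZero ν' := ⟨by rintro rfl; simp at hmass⟩
  have hlaw' : P'.map X' = ν'.map fun x i => (x i : ℝ) :=
    map_eq_of_integral_exp_eq hX'.aemeasurable fun s => (hXs' s).trans (hL' s).symm
  have hLν : ∀ s : Fin n → NNReal, ∫ x, expNegDot s x ∂(r.toNNReal • ν' + ρ) =
      1 / (1 + A⁻¹ * Matrix.diagonal fun i => (s i : ℝ)).det ^ α := fun s => by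
    rw [integral_add_measure (integrable_expNegDot _ s) (integrable_expNegDot _ s),
      integral_smul_nnreal_measure, hL', hLρ, NNReal.smul_def, Real.coe_toNNReal r hr0,
      smul_eq_mul]
    ring
  have hmassν : (r.toNNReal • ν' + ρ).real Set.univ = 1 := by
    simpa using hLν 0
  have hne : NeZero (r.toNNReal • ν' + ρ) := ⟨by intro h0; simp [h0] at hmassν⟩
  have hlaw : P.map X = (r.toNNReal • ν' + ρ).map fun x i => (x i : ℝ) :=
    map_eq_of_integral_exp_eq hX.aemeasurable fun s => (hXs s).trans (hLν s).symm
  have hco : Measurable fun (x : Fin n → NNReal) (i : Fin n) => (x i : ℝ) := by fun_prop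
  have key : ∀ T : Set (Fin n → ℝ), MeasurableSet T →
      r * (P'.map X').real T ≤ (P.map X).real T := by
    intro T hT
    rw [hlaw, hlaw', map_measureReal_apply hco hT, map_measureReal_apply hco hT,
      measureReal_add_apply, measureReal_nnreal_smul_apply, Real.coe_toNNReal r hr0]
    exact le_add_of_nonneg_right measureReal_nonneg
  have hP : P.real {ω | g (X ω) ∈ B} = (P.map X).real (g ⁻¹' B) :=
    (map_measureReal_apply_of_aemeasurable hX.aemeasurable hgB).symm
  have hP' : P'.real {ω | g (X' ω) ∈ B} = (P'.map X').real (g ⁻¹' B) :=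
    (map_measureReal_apply_of_aemeasurable hX'.aemeasurable hgB).symm
  have i1 : IsProbabilityMeasure (P.map X) := Measure.isProbabilityMeasure_map hX.aemeasurable
  have i2 : IsProbabilityMeasure (P'.map X') := Measure.isProbabilityMeasure_map hX'.aemeasurable
  rw [hP, hP']
  refine ⟨key _ hgB, ?_⟩
  -- The upper bound is the lower bound for the complement.
  have h := key _ hgB.compl
  rw [probReal_compl_eq_one_sub hgB, probReal_compl_eq_one_sub hgB] at h
  linarith
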